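/- Let $G$ be a locally compact group with left Haar measure $dq$ and modular function $\delta$, normalised by $\int f(qp)\,dq=\delta(p)^{-1}\int f(q)\,dq$ for $f\in C_c(G)$, where $C_c(G)$ is the space of continuous complex functions on $G$ with compact support. The convolution algebra $C_c(G)$ is the $^*$-algebra with underlying space $C_c(G)$, product $$(f*f')(p)=\int f(q)f'(q^{-1}p)\,dq$$ and involution $f^*(p)=\delta(p)^{-1}\,\overline{f(p^{-1})}$. A function $f\in C_c(G)$ is called polynomial if there are an open neighbourhood $V$ of the identity in $G$ and a finite-dimensional subspace $F$ of $C_c(G)$ such that for every $v\in V$ the function $p\mapsto f(pv)$ belongs to $F$. Let $\mathcal P(G)$ be the set of polynomial functions in $C_c(G)$. Assume that $G$ has a compact open subgroup. Then: 1. For all $f,f'\in C_c(G)$, the convolution product $f*f'$ is polynomial as soon as $f$ or $f'$ is polynomial. 2. $\mathcal P(G)$ is a two-sided ideal of the convolution algebra $C_c(G)$, closed under the involution $f\mapsto f^*$. In particular it is a $^*$-subalgebra of the convolution algebra $C_c(G)$. 3. $\mathcal P(G)$ has local units: for every finite subset $S$ of $\mathcal P(G)$ there is $g\in\mathcal P(G)$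 with $g*f=f$ and $f*g=f$ for all $f\in S$. 4. The product of $\mathcal P(G)$ is non-degenerate: if $f\in\mathcal P(G)$ and $f*g=0$ for all $g\in\mathcal P(G)$, then $f=0$; and if $g*f=0$ for all $g\in\mathcal P(G)$, then $f=0$. -/

import Mathlib

open MeasureTheory MeasureTheory.Measure Set Topology
open scoped NNReal CompactlySupported ComplexConjugate Pointwise

noncomputable section

namespace PolyFun

section Modular

variable {G : Type*} [Group G] [TopologicalSpace G] [IsTopologicalGroup G] [LocallyCompactSpace G]

/-- The modular function `δ` of `G`, in the convention `μ (A p) = δ p * μ A` for a left Haar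
measure `μ`, equivalently `∫ f (q p) dq = (δ p)⁻¹ * ∫ f q dq`
(see `integral_mul_right_eq_modular`).
Mathlib's `modularCharacter` is normalised by `μ (A p⁻¹) = modularCharacter p * μ A`. -/
def modularFunction (p : G) : ℝ :=
  (modularCharacter p⁻¹ : ℝ≥0)

lemma modularFunction_pos (p : G) : 0 < modularFunction p :=
  NNReal.coe_pos.2 (modularCharacterFun_pos p⁻¹)

lemma modularFunction_mul (p q : G) :
    modularFunction (p * q) = modularFunction p * modularFunction q := by
  simp [modularFunction, mul_comm]

lemma modularFunction_one : modularFunction (1 : G) = 1 := by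
  simp [modularFunction]

lemma modularFunction_inv (p : G) : modularFunction p⁻¹ = (modularFunction p)⁻¹ := by
  have h := modularFunction_mul p p⁻¹
  rw [mul_inv_cancel, modularFunction_one] at h
  exact eq_inv_of_mul_eq_one_right h.symm

lemma integral_mul_right_eq_modular [MeasurableSpace G] [BorelSpace G] (μ : Measure G)
    [IsHaarMeasure μ] {f : G → ℝ} (hf : Continuous f) (h'f : HasCompactSupport f) (p : G) :
    ∫ q, f (q * p) ∂μ = (modularFunction p)⁻¹ * ∫ q, f q ∂μ := by
  have h1 : (modularFunction p)⁻¹ = (haarScalarFactor (map (· * p) μ) μ : ℝ) := by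
    rw [← modularFunction_inv, modularFunction, inv_inv,
      ← modularCharacterFun_eq_haarScalarFactor μ p]
    rfl
  have h2 := integral_isMulLeftInvariant_eq_smul_of_hasCompactSupport (map (· * p) μ) μ hf h'f
  rw [integral_map (by fun_prop) hf.aestronglyMeasurable, integral_smul_nnreal_measure] at h2
  rw [h2, h1]
  rfl

lemma continuous_modularFunction : Continuous (modularFunction : G → ℝ) := by
  borelize G
  let μ : Measure G := MeasureTheory.Measure.haar
  obtain ⟨⟨f, f_cont⟩, f_comp, f_nonneg, f_one⟩ :
    ∃ f : C(G, ℝ), HasCompactSupport f ∧ 0 ≤ f ∧ f 1 ≠ 0 := exists_continuous_nonneg_pos 1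
  have hf : ∫ x, f x ∂μ ≠ 0 :=
    ne_of_gt (f_cont.integral_pos_of_hasCompactSupport_nonneg_nonzero f_comp f_nonneg f_one)
  have key : ∀ p : G, modularFunction p = (∫ q, f (q * p⁻¹) ∂μ) / ∫ q, f q ∂μ := by
    intro p
    rw [integral_mul_right_eq_modular μ f_cont f_comp, modularFunction_inv, inv_inv,
      mul_div_cancel_right₀ _ hf]
  have hD : Continuous fun p : G => ∫ q, f (q * p⁻¹) ∂μ := by
    refine continuous_iff_continuousAt.2 fun p₀ => ?_
    obtain ⟨t, t_comp, ht⟩ : ∃ t, IsCompact t ∧ t ∈ 𝓝 p₀ := exists_compact_mem_nhds p₀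
    have A : ContinuousOn (fun p : G => ∫ q, f (q * p⁻¹) ∂μ) t := by
      refine continuousOn_integral_of_compact_support (IsCompact.mul f_comp t_comp) ?_ ?_
      · exact (f_cont.comp (continuous_snd.mul continuous_fst.inv)).continuousOn
      · intro p q hp hq
        refine image_eq_zero_of_notMem_tsupport fun h => hq ?_
        exact ⟨q * p⁻¹, h, p, hp, by simp⟩
    exact A.continuousAt ht
  rw [show (modularFunction : G → ℝ) = fun p => (∫ q, f (q * p⁻¹) ∂μ) / ∫ q, f q ∂μ from funext key]
  exact hD.div_const _

end Modular

section Polynomial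

variable {G : Type*} [Group G] [TopologicalSpace G] [IsTopologicalGroup G]

/-- The function `v · f : p ↦ f (p v)`. -/
def translate (v : G) (f : C_c(G, ℂ)) : C_c(G, ℂ) where
  toFun p := f (p * v)
  continuous_toFun := f.continuous.comp (continuous_mul_const v)
  hasCompactSupport' := f.hasCompactSupport.comp_homeomorph (Homeomorph.mulRight v)

/-- `f ∈ C_c(G)` is polynomial (for the action of `G` on itself by right multiplication) if for
some open neighbourhood `V` of the identity, the functions `v · f`, `v ∈ V`, all lie in one
finite-dimensional subspace of `C_c(G)`. -/
def IsPolynomial (f : C_c(G, ℂ)) : Prop :=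
  ∃ V : Set G, IsOpen V ∧ (1 : G) ∈ V ∧
    ∃ F : Submodule ℂ C_c(G, ℂ), FiniteDimensional ℂ F ∧ ∀ v ∈ V, translate v f ∈ F

end Polynomial

section Convolution

variable {G : Type*} [Group G] [TopologicalSpace G] [IsTopologicalGroup G]
  [MeasurableSpace G] [BorelSpace G]

lemma continuous_conv_aux (μ : Measure G) [IsHaarMeasure μ] (f g : C_c(G, ℂ)) :
    Continuous fun p : G => ∫ q, f q * g (q⁻¹ * p) ∂μ := by
  rw [← continuousOn_univ]
  refine continuousOn_integral_of_compact_support (k := tsupport f) f.hasCompactSupport ?_ ?_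
  · exact (Continuous.mul (f.continuous.comp continuous_snd)
      (g.continuous.comp (continuous_snd.inv.mul continuous_fst))).continuousOn
  · intro p q _ hq
    simp [image_eq_zero_of_notMem_tsupport hq]

lemma hasCompactSupport_conv_aux (μ : Measure G) (f g : C_c(G, ℂ)) :
    HasCompactSupport fun p : G => ∫ q, f q * g (q⁻¹ * p) ∂μ := by
  refine HasCompactSupport.of_support_subset_isCompact
    (IsCompact.mul f.hasCompactSupport g.hasCompactSupport) fun p hp => ?_
  by_contra hn
  refine hp ?_
  have : ∀ q, f q * g (q⁻¹ * p) = 0 := by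
    intro q
    by_contra h
    rw [mul_eq_zero, not_or] at h
    exact hn ⟨q, subset_tsupport _ h.1, q⁻¹ * p, subset_tsupport _ h.2, by simp⟩
  simp [this]

/-- The convolution product `(f * g)(p) = ∫ f(q) g(q⁻¹ p) dq` for the left Haar measure `μ`. -/
def conv (μ : Measure G) [IsHaarMeasure μ] (f g : C_c(G, ℂ)) : C_c(G, ℂ) where
  toFun p := ∫ q, f q * g (q⁻¹ * p) ∂μ
  continuous_toFun := continuous_conv_aux μ f g
  hasCompactSupport' := hasCompactSupport_conv_aux μ f g

lemma conv_apply (μ : Measure G) [IsHaarMeasure μ] (f g : C_c(G, ℂ)) (p : G) :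
    conv μ f g p = ∫ q, f q * g (q⁻¹ * p) ∂μ := rfl

lemma integrable_conv_aux (μ : Measure G) [IsHaarMeasure μ] (f g : C_c(G, ℂ)) (p : G) :
    Integrable (fun q => f q * g (q⁻¹ * p)) μ := by
  refine Continuous.integrable_of_hasCompactSupport ?_ ?_
  · exact f.continuous.mul (g.continuous.comp (continuous_inv.mul continuous_const))
  · exact f.hasCompactSupport.mul_right

lemma add_conv (μ : Measure G) [IsHaarMeasure μ] (f f' g : C_c(G, ℂ)) :
    conv μ (f + f') g = conv μ f g + conv μ f' g := by
  ext p
  simp only [conv_apply, CompactlySupportedContinuousMap.coe_add, Pi.add_apply, add_mul]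
  exact integral_add (integrable_conv_aux μ f g p) (integrable_conv_aux μ f' g p)

lemma conv_add (μ : Measure G) [IsHaarMeasure μ] (f g g' : C_c(G, ℂ)) :
    conv μ f (g + g') = conv μ f g + conv μ f g' := by
  ext p
  simp only [conv_apply, CompactlySupportedContinuousMap.coe_add, Pi.add_apply, mul_add]
  exact integral_add (integrable_conv_aux μ f g p) (integrable_conv_aux μ f g' p)

lemma smul_conv (μ : Measure G) [IsHaarMeasure μ] (c : ℂ) (f g : C_c(G, ℂ)) :
    conv μ (c • f) g = c • conv μ f g := by
  ext p
  simp only [conv_apply, CompactlySupportedContinuousMap.coe_smul, Pi.smul_apply, smul_eq_mul,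
    mul_assoc]
  exact integral_const_mul _ _

lemma conv_smul (μ : Measure G) [IsHaarMeasure μ] (c : ℂ) (f g : C_c(G, ℂ)) :
    conv μ f (c • g) = c • conv μ f g := by
  ext p
  simp only [conv_apply, CompactlySupportedContinuousMap.coe_smul, Pi.smul_apply, smul_eq_mul,
    mul_left_comm _ c]
  exact integral_const_mul _ _

lemma zero_conv (μ : Measure G) [IsHaarMeasure μ] (g : C_c(G, ℂ)) : conv μ 0 g = 0 := by
  simpa using smul_conv μ 0 0 g

lemma conv_zero (μ : Measure G) [IsHaarMeasure μ] (f : C_c(G, ℂ)) : conv μ f 0 = 0 := by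
  simpa using conv_smul μ 0 f 0

lemma conv_assoc (μ : Measure G) [IsHaarMeasure μ] (f g h : C_c(G, ℂ)) :
    conv μ (conv μ f g) h = conv μ f (conv μ g h) := by
  ext p
  simp only [conv_apply, ← integral_const_mul, ← integral_mul_const]
  rw [integral_integral_swap_of_hasCompactSupport]
  · congr 1
    ext r
    rw [← integral_mul_left_eq_self _ r]
    congr 1
    ext q
    simp only [inv_mul_cancel_left, mul_inv_rev, mul_assoc]
  · exact ((f.continuous.comp continuous_snd).mul
      (g.continuous.comp (continuous_snd.inv.mul continuous_fst))).mul
      (h.continuous.comp (continuous_fst.inv.mul continuous_const))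
  · refine HasCompactSupport.of_support_subset_isCompact
      ((IsCompact.mul f.hasCompactSupport g.hasCompactSupport).prod f.hasCompactSupport) ?_
    rintro ⟨q, r⟩ hqr
    simp only [Function.mem_support, Function.uncurry_apply_pair, ne_eq, mul_eq_zero, not_or] at hqr
    exact ⟨⟨r, subset_tsupport _ hqr.1.1, r⁻¹ * q, subset_tsupport _ hqr.1.2, by simp⟩,
      subset_tsupport _ hqr.1.1⟩

end Convolution

section Involution

variable {G : Type*} [Group G] [TopologicalSpace G] [IsTopologicalGroup G] [LocallyCompactSpace G]

/-- The involution `f* (p) = δ(p)⁻¹ * conj (f (p⁻¹))`. -/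
def involution (f : C_c(G, ℂ)) : C_c(G, ℂ) where
  toFun p := (((modularFunction p)⁻¹ : ℝ) : ℂ) * conj (f p⁻¹)
  continuous_toFun :=
    (Complex.continuous_ofReal.comp
      (continuous_modularFunction.inv₀ fun p => (modularFunction_pos p).ne')).mul
      (Complex.continuous_conj.comp (f.continuous.comp continuous_inv))
  hasCompactSupport' := by
    have h1 : HasCompactSupport fun p : G => f p⁻¹ :=
      f.hasCompactSupport.comp_homeomorph (Homeomorph.inv G)
    have h2 : HasCompactSupport fun p : G => conj (f p⁻¹) := h1.comp_left (map_zero _)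
    exact h2.mul_left

lemma involution_apply (f : C_c(G, ℂ)) (p : G) :
    involution f p = (((modularFunction p)⁻¹ : ℝ) : ℂ) * conj (f p⁻¹) := rfl

lemma involution_involution (f : C_c(G, ℂ)) : involution (involution f) = f := by
  ext p
  have h : ((modularFunction p : ℝ) : ℂ) ≠ 0 :=
    Complex.ofReal_ne_zero.2 (modularFunction_pos p).ne'
  simp [involution_apply, modularFunction_inv, h]

lemma involution_add (f g : C_c(G, ℂ)) :
    involution (f + g) = involution f + involution g := by
  ext p
  simp [involution_apply, mul_add]

lemma involution_smul (c : ℂ) (f : C_c(G, ℂ)) :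
    involution (c • f) = conj c • involution f := by
  ext p
  simp [involution_apply, mul_left_comm]

lemma involution_conv [MeasurableSpace G] [BorelSpace G] (μ : Measure G) [IsHaarMeasure μ]
    (f g : C_c(G, ℂ)) :
    involution (conv μ f g) = conv μ (involution g) (involution f) := by
  ext p
  simp only [involution_apply, conv_apply]
  rw [← integral_conj, ← integral_const_mul,
    ← integral_mul_left_eq_self (fun q => (((modularFunction q)⁻¹ : ℝ) : ℂ) * _ * _) p]
  congr 1
  ext q
  have h1 : ((modularFunction p : ℝ) : ℂ) ≠ 0 :=
    Complex.ofReal_ne_zero.2 (modularFunction_pos p).ne'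
  have h2 : ((modularFunction q : ℝ) : ℂ) ≠ 0 :=
    Complex.ofReal_ne_zero.2 (modularFunction_pos q).ne'
  simp only [modularFunction_mul, modularFunction_inv, mul_inv_rev, inv_inv, map_mul,
    Complex.ofReal_mul, Complex.ofReal_inv, inv_mul_cancel_right]
  field_simp

end Involution

section ConvAlg

/-- The convolution algebra of `G` with respect to the left Haar measure `μ`: the vector space
`C_c(G)` with the convolution product and the involution `f*`. It is a type synonym, since Mathlib
equips `C_c(G, ℂ)` with the pointwise product and the pointwise involution. -/
def ConvAlg {G : Type*} [TopologicalSpace G] [MeasurableSpace G] (_μ : Measure G) : Type _ :=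
  C_c(G, ℂ)

namespace ConvAlg

variable {G : Type*} [Group G] [TopologicalSpace G] [IsTopologicalGroup G] [LocallyCompactSpace G]
  [MeasurableSpace G] [BorelSpace G] (μ : Measure G)

instance : AddCommGroup (ConvAlg μ) := inferInstanceAs (AddCommGroup C_c(G, ℂ))

instance : Module ℂ (ConvAlg μ) := inferInstanceAs (Module ℂ C_c(G, ℂ))

/-- The identity map, from the convolution algebra to its underlying space `C_c(G)`. -/
def toCc : ConvAlg μ ≃ₗ[ℂ] C_c(G, ℂ) := LinearEquiv.refl ℂ C_c(G, ℂ)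

variable [IsHaarMeasure μ]

instance : Mul (ConvAlg μ) where
  mul f g := (toCc μ).symm (conv μ (toCc μ f) (toCc μ g))

instance : Star (ConvAlg μ) where
  star f := (toCc μ).symm (involution (toCc μ f))

lemma toCc_mul (f g : ConvAlg μ) : toCc μ (f * g) = conv μ (toCc μ f) (toCc μ g) := rfl

lemma toCc_star (f : ConvAlg μ) : toCc μ (star f) = involution (toCc μ f) := rfl

instance : NonUnitalRing (ConvAlg μ) where
  left_distrib f g h := conv_add μ (toCc μ f) (toCc μ g) (toCc μ h)
  right_distrib f g h := add_conv μ (toCc μ f) (toCc μ g) (toCc μ h)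
  zero_mul f := zero_conv μ (toCc μ f)
  mul_zero f := conv_zero μ (toCc μ f)
  mul_assoc f g h := conv_assoc μ (toCc μ f) (toCc μ g) (toCc μ h)

instance : IsScalarTower ℂ (ConvAlg μ) (ConvAlg μ) where
  smul_assoc c f g := smul_conv μ c (toCc μ f) (toCc μ g)

instance : SMulCommClass ℂ (ConvAlg μ) (ConvAlg μ) where
  smul_comm c f g := (conv_smul μ c (toCc μ f) (toCc μ g)).symm

instance : StarRing (ConvAlg μ) where
  star_involutive f := involution_involution (toCc μ f)
  star_mul f g := involution_conv μ (toCc μ f) (toCc μ g)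
  star_add f g := involution_add (toCc μ f) (toCc μ g)

instance : StarModule ℂ (ConvAlg μ) where
  star_smul c f := involution_smul c (toCc μ f)

end ConvAlg

/-- A (not necessarily unital) ring has local units if every finite set of elements has a common
two-sided unit in the ring. -/
def HasLocalUnits (A : Type*) [NonUnitalRing A] : Prop :=
  ∀ s : Finset A, ∃ e : A, ∀ a ∈ s, e * a = a ∧ a * e = a

end ConvAlg

end PolyFun

end

/-! Right translation of `conv μ f g` only moves `g`, so the product is polynomial when `g` is. The
other side follows from `f * g = (g* * f*)*` once the involution preserves polynomials. It exchanges
right and left translates, so left translates near the identity must also span a finite-dimensional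
space. This is "row rank equals column rank": on a set `x V` the function `f (u⁻¹ x v)` of `v` is a
matrix coefficient, the functional "evaluate at `u⁻¹ x`" applied to `translate v f ∈ F`
(`finiteDimensional_span_of_eq_left_translates`).

For local units, let `H` be a compact open subgroup. The same principle shows that the functions `q
↦ f (p q)` on `H`, with `f` in a finite set of polynomial functions, span a finite-dimensional `M`.
The pairing `(g, m) ↦ (m * g)(1)` is non-degenerate in `M`, since `g = m*` gives `∫ δ |m|²`. So some
polynomial `g` supported on `H` represents evaluation at `1` on `M`; unfolded at each `p`, this says
`f * g = f`. The involution gives left units, and `l + r - r * l` is a unit on both sides.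
Non-degeneracy is then immediate. -/

namespace PolyFun

/-! ### Finite-dimensional linear algebra. -/

section LinearAlgebra

variable {k E D W : Type*} [Field k] [AddCommGroup E] [Module k E] [AddCommGroup D] [Module k D]
  [AddCommGroup W] [Module k W]

/-- A subspace is finite-dimensional if a linear map embeds it into the range of a linear map with
finite-dimensional domain. -/
lemma finiteDimensional_of_map_le_range [FiniteDimensional k D] (S : Submodule k E) (Φ : E →ₗ[k] W)
    (R : D →ₗ[k] W) (hR : S ≤ (LinearMap.range R).comap Φ) (hΦ : ∀ x ∈ S, Φ x = 0 → x = 0) :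
    FiniteDimensional k S := by
  let Ψ : S →ₗ[k] LinearMap.range R := (Φ.domRestrict S).codRestrict _ fun x => hR x.2
  refine FiniteDimensional.of_injective Ψ (LinearMap.ker_eq_bot.1
    (LinearMap.ker_eq_bot'.2 fun x hx => ?_))
  exact Subtype.ext (hΦ x x.2 (congrArg Subtype.val hx))

/-- A linear functional on a finite-dimensional subspace `M` is represented by an element of `N` if
a bilinear form pairs `N` and `M` without degeneration in `M`. -/
lemma exists_mem_forall_eq_of_separating (b : E →ₗ[k] E →ₗ[k] k) (N M : Submodule k E)
    [FiniteDimensional k M] (h : ∀ m ∈ M, (∀ g ∈ N, b g m = 0) → m = 0) (l : E →ₗ[k] k) :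
    ∃ g ∈ N, ∀ m ∈ M, b g m = l m := by
  let B : N →ₗ[k] Module.Dual k M := b.domRestrict₁₂ N M
  -- As `M` is finite-dimensional, `N → M*` is onto iff its transpose `M → N*` is injective, which
  -- is `h`.
  have hB : Function.Surjective B := by
    refine LinearMap.flip_injective_iff₂.1 (LinearMap.ker_eq_bot.1
      (LinearMap.ker_eq_bot'.2 fun m hm => ?_))
    exact Subtype.ext (h m m.2 fun g hg => LinearMap.congr_fun hm ⟨g, hg⟩)
  obtain ⟨g, hg⟩ := hB (l.domRestrict M)
  exact ⟨g, g.2, fun m hm => LinearMap.congr_fun hg ⟨m, hm⟩⟩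

end LinearAlgebra

/-! ### Translations and restriction to open subgroups. -/

section Translation

variable {G : Type*} [Group G] [TopologicalSpace G] [IsTopologicalGroup G]

/-- Right translation as a linear map on `C_c(G)`. -/
noncomputable def translateₗ (v : G) : C_c(G, ℂ) →ₗ[ℂ] C_c(G, ℂ) where
  toFun := translate v
  map_add' _ _ := rfl
  map_smul' _ _ := rfl

lemma translate_apply (v : G) (f : C_c(G, ℂ)) (p : G) : translate v f p = f (p * v) := rfl

/-- Left translation `f ↦ (p ↦ f (u⁻¹ p))` as a linear map on `C_c(G)`. -/
noncomputable def leftTranslate (u : G) : C_c(G, ℂ) →ₗ[ℂ] C_c(G, ℂ) where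
  toFun f :=
    { toFun := fun p => f (u⁻¹ * p)
      continuous_toFun := f.continuous.comp (continuous_const_mul u⁻¹)
      hasCompactSupport' := f.hasCompactSupport.comp_homeomorph (Homeomorph.mulLeft u⁻¹) }
  map_add' _ _ := rfl
  map_smul' _ _ := rfl

lemma leftTranslate_apply (u : G) (f : C_c(G, ℂ)) (p : G) :
    leftTranslate u f p = f (u⁻¹ * p) := rfl

/-- Restriction of functions to an open subgroup, followed by extension by zero. -/
noncomputable def restrictSubgroup (H : Subgroup G) (hH : IsOpen (H : Set G)) :
    C_c(G, ℂ) →ₗ[ℂ] C_c(G, ℂ) where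
  toFun f :=
    { toFun := (H : Set G).indicator f
      continuous_toFun :=
        IsClopen.continuous_indicator ⟨H.isClosed_of_isOpen hH, hH⟩ f.continuous
      hasCompactSupport' := f.hasCompactSupport.mono (by
        rw [Set.support_indicator]
        exact inter_subset_right) }
  map_add' f g := by
    ext p
    exact congrFun (Set.indicator_add (H : Set G) f g) p
  map_smul' c f := by
    ext p
    exact congrFun (Set.indicator_const_smul (H : Set G) c f) p

lemma restrictSubgroup_apply_of_mem {H : Subgroup G} (hH : IsOpen (H : Set G)) (f : C_c(G, ℂ))
    {p : G} (hp : p ∈ H) : restrictSubgroup H hH f p = f p :=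
  Set.indicator_of_mem (s := (H : Set G)) hp f

lemma restrictSubgroup_apply_of_notMem {H : Subgroup G} (hH : IsOpen (H : Set G)) (f : C_c(G, ℂ))
    {p : G} (hp : p ∉ H) : restrictSubgroup H hH f p = 0 :=
  Set.indicator_of_notMem (s := (H : Set G)) hp f

/-- The functions in `C_c(G)` which vanish outside a subgroup. -/
def supportedOn (H : Subgroup G) : Submodule ℂ C_c(G, ℂ) where
  carrier := {f | ∀ p ∉ H, f p = 0}
  zero_mem' _ _ := rfl
  add_mem' hf hg p hp := by simp [hf p hp, hg p hp]
  smul_mem' c f hf p hp := by simp [hf p hp]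

/-- Finitely many left translates of an open neighbourhood of the identity cover a compact set. -/
lemma exists_finset_subset_mul {K V : Set G} (hK : IsCompact K) (hV : IsOpen V)
    (h1 : (1 : G) ∈ V) : ∃ t : Finset G, K ⊆ (t : Set G) * V := by
  obtain ⟨t, -, ht⟩ := hK.elim_nhds_subcover (fun x => x • V)
    fun x _ => (hV.smul x).mem_nhds ⟨1, h1, by simp⟩
  refine ⟨t, fun p hp => ?_⟩
  obtain ⟨x, hx, v, hv, rfl⟩ := mem_iUnion₂.1 (ht hp)
  exact ⟨x, hx, v, hv, rfl⟩

end Translation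

/-! ### Polynomial functions and their translates. -/

section Polynomial

variable {G : Type*} [Group G] [TopologicalSpace G] [IsTopologicalGroup G]

/-- A set of functions is contained in a finite-dimensional space if its members vanish outside
finitely many sets `x V`, and are there given by left translates of a function `f` whose right
translates by elements of `V` span a finite-dimensional space. -/
lemma finiteDimensional_span_of_eq_left_translates {f : C_c(G, ℂ)} {F : Submodule ℂ C_c(G, ℂ)}
    [FiniteDimensional ℂ F] {V : Set G} (hF : ∀ v ∈ V, translate v f ∈ F) (t : Finset G)
    {T : Set C_c(G, ℂ)} (h0 : ∀ g ∈ T, ∀ p ∉ (t : Set G) * V, g p = 0)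
    (h : ∀ g ∈ T, ∀ x ∈ t, ∃ p, ∀ v ∈ V, g (x * v) = f (p * v)) :
    FiniteDimensional ℂ (Submodule.span ℂ T) := by
  -- A functional on `F` is sent to its matrix coefficient on `V`, its values at the translates of
  -- `f`.
  let ρ : Module.Dual ℂ F →ₗ[ℂ] (V → ℂ) :=
    LinearMap.pi fun v => Module.Dual.eval ℂ F ⟨translate v f, hF v v.2⟩
  let R : (t → Module.Dual ℂ F) →ₗ[ℂ] (t → V → ℂ) :=
    LinearMap.pi fun x => ρ ∘ₗ LinearMap.proj x
  let Φ : C_c(G, ℂ) →ₗ[ℂ] (t → V → ℂ) :=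
    { toFun := fun g x v => g (x * v)
      map_add' := fun _ _ => rfl
      map_smul' := fun _ _ => rfl }
  have hR : Submodule.span ℂ T ≤ (LinearMap.range R).comap Φ := by
    refine Submodule.span_le.2 fun g hg => ?_
    choose p hp using h g hg
    let ev : G → Module.Dual ℂ F := fun q =>
      { toFun := fun k => (k : C_c(G, ℂ)) q
        map_add' := fun _ _ => rfl
        map_smul' := fun _ _ => rfl }
    refine ⟨fun x => ev (p x x.2), ?_⟩
    ext x v
    exact (hp x x.2 v v.2).symm
  -- This makes `Φ` injective on the span: `Φ` only sees values on the sets `x V`.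
  have hZ : ∀ g ∈ Submodule.span ℂ T, ∀ p ∉ (t : Set G) * V, g p = 0 := by
    intro g hg p hp
    induction hg using Submodule.span_induction with
    | mem g hg => exact h0 g hg p hp
    | zero => rfl
    | add g k _ _ hg hk => simp [hg, hk]
    | smul c g _ hg => simp [hg]
  have : FiniteDimensional ℂ (Module.Dual ℂ F) :=
    Subspace.instModuleDualFiniteDimensional (K := ℂ) (V := F)
  have : FiniteDimensional ℂ (t → Module.Dual ℂ F) := Module.Finite.pi
  refine finiteDimensional_of_map_le_range _ Φ R hR fun g hg hg' => ?_
  ext p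
  by_cases hp : p ∈ (t : Set G) * V
  · obtain ⟨x, hx, v, hv, rfl⟩ := hp
    exact congrFun (congrFun hg' ⟨x, hx⟩) ⟨v, hv⟩
  · exact hZ g hg p hp

/-- The subspace of polynomial functions. -/
def polynomial (G : Type*) [Group G] [TopologicalSpace G] [IsTopologicalGroup G] :
    Submodule ℂ C_c(G, ℂ) where
  carrier := {f | IsPolynomial f}
  zero_mem' := ⟨univ, isOpen_univ, mem_univ _, ⊥, inferInstance, fun v _ =>
    (translateₗ v).map_zero⟩
  add_mem' := by
    rintro f g ⟨V, hV, hV1, F, _, hF⟩ ⟨W, hW, hW1, E, _, hE⟩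
    exact ⟨V ∩ W, hV.inter hW, ⟨hV1, hW1⟩, F ⊔ E, inferInstance, fun v hv =>
      Submodule.add_mem_sup (hF v hv.1) (hE v hv.2)⟩
  smul_mem' := by
    rintro c f ⟨V, hV, hV1, F, hFd, hF⟩
    exact ⟨V, hV, hV1, F, hFd, fun v hv => F.smul_mem c (hF v hv)⟩

/-- A linear map which commutes with right translation by elements near the identity preserves
polynomial functions. -/
lemma IsPolynomial.map {f : C_c(G, ℂ)} (hf : IsPolynomial f) (T : C_c(G, ℂ) →ₗ[ℂ] C_c(G, ℂ))
    {W : Set G} (hW : IsOpen W) (hW1 : (1 : G) ∈ W)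
    (hT : ∀ v ∈ W, translate v (T f) = T (translate v f)) : IsPolynomial (T f) := by
  obtain ⟨V, hV, hV1, F, _, hF⟩ := hf
  refine ⟨V ∩ W, hV.inter hW, ⟨hV1, hW1⟩, F.map T, inferInstance, fun v hv => ?_⟩
  rw [hT v hv.2]
  exact Submodule.mem_map_of_mem (hF v hv.1)

lemma IsPolynomial.leftTranslate {f : C_c(G, ℂ)} (hf : IsPolynomial f) (u : G) :
    IsPolynomial (leftTranslate u f) :=
  hf.map _ isOpen_univ (mem_univ _) fun v _ => by
    ext p
    simp [translate_apply, leftTranslate_apply, mul_assoc]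

/-- Right translation by elements of `H` preserves both `H` and its complement, hence commutes with
the restriction; openness makes `H` a neighbourhood of the identity. -/
lemma IsPolynomial.restrictSubgroup {f : C_c(G, ℂ)} (hf : IsPolynomial f) {H : Subgroup G}
    (hH : IsOpen (H : Set G)) : IsPolynomial (restrictSubgroup H hH f) := by
  refine hf.map _ hH H.one_mem fun v hv => ?_
  ext p
  rw [translate_apply]
  by_cases hp : p ∈ H
  · rw [restrictSubgroup_apply_of_mem hH _ hp,
      restrictSubgroup_apply_of_mem hH _ (H.mul_mem hp hv), translate_apply]
  · rw [restrictSubgroup_apply_of_notMem hH _ hp,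
      restrictSubgroup_apply_of_notMem hH _ fun h => hp ((H.mul_mem_cancel_right hv).1 h)]

/-- The right translates of a polynomial function by the elements of a compact set lie in a
finite-dimensional space. -/
lemma IsPolynomial.exists_finiteDimensional {f : C_c(G, ℂ)} (hf : IsPolynomial f) {K : Set G}
    (hK : IsCompact K) : ∃ F : Submodule ℂ C_c(G, ℂ), FiniteDimensional ℂ F ∧
      ∀ v ∈ K, translate v f ∈ F := by
  obtain ⟨V, hV, hV1, F, _, hF⟩ := hf
  obtain ⟨t, ht⟩ := exists_finset_subset_mul hK hV hV1
  refine ⟨t.sup fun x => F.map (translateₗ x), inferInstance, fun p hp => ?_⟩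
  obtain ⟨x, hx, v, hv, rfl⟩ := ht hp
  refine Finset.le_sup (f := fun x => F.map (translateₗ x)) hx ⟨translate v f, hF v hv, ?_⟩
  ext q
  exact congrArg f (mul_assoc q x v)

/-- The left translates of a polynomial function by elements near the identity lie in a
finite-dimensional space. -/
lemma IsPolynomial.exists_finiteDimensional_leftTranslate {f : C_c(G, ℂ)} (hf : IsPolynomial f) :
    ∃ U : Set G, IsOpen U ∧ (1 : G) ∈ U ∧ ∃ F : Submodule ℂ C_c(G, ℂ), FiniteDimensional ℂ F ∧
      ∀ u ∈ U, PolyFun.leftTranslate u f ∈ F := by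
  obtain ⟨V, hV, hV1, F, _, hF⟩ := hf
  have hK : IsCompact (tsupport f) := f.hasCompactSupport
  obtain ⟨t, ht⟩ := exists_finset_subset_mul hK hV hV1
  -- For `u ∈ U` the translated support `u K` stays inside the open set `t V`, so one `t` serves all
  -- `u`.
  obtain ⟨U, hU, hUK⟩ := compact_open_separated_mul_left hK hV.mul_left ht
  refine ⟨interior U, isOpen_interior, mem_interior_iff_mem_nhds.2 hU,
    Submodule.span ℂ ((fun u => PolyFun.leftTranslate u f) '' interior U), ?_,
    fun u hu => Submodule.subset_span ⟨u, hu, rfl⟩⟩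
  refine finiteDimensional_span_of_eq_left_translates hF t ?_ ?_
  · rintro _ ⟨u, hu, rfl⟩ p hp
    by_contra hne
    exact hp (hUK ⟨u, interior_subset hu, u⁻¹ * p, subset_tsupport _ hne, by simp⟩)
  · rintro _ ⟨u, hu, rfl⟩ x hx
    exact ⟨u⁻¹ * x, fun v _ => congrArg f (mul_assoc u⁻¹ x v).symm⟩

end Polynomial

/-! ### Involution and convolution of polynomial functions. -/

section Convolution

variable {G : Type*} [Group G] [TopologicalSpace G] [IsTopologicalGroup G] [LocallyCompactSpace G]

/-- The involution of `C_c(G)` as a conjugate-linear map. -/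
noncomputable def involutionₛₗ : C_c(G, ℂ) →ₛₗ[starRingEnd ℂ] C_c(G, ℂ) where
  toFun := involution
  map_add' := involution_add
  map_smul' := involution_smul

/-- A right translate of `f*` is, up to a value of the modular function, the involution of a left
translate of `f`. -/
lemma IsPolynomial.involution {f : C_c(G, ℂ)} (hf : IsPolynomial f) :
    IsPolynomial (involution f) := by
  obtain ⟨U, hU, hU1, F, hFd, hF⟩ := hf.exists_finiteDimensional_leftTranslate
  refine ⟨U, hU, hU1, F.map involutionₛₗ, ?_, fun v hv => ?_⟩
  · exact Module.Finite.iff_fg.2 ((Module.Finite.iff_fg.1 hFd).map _)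
  · have h : translate v (PolyFun.involution f) =
        (((modularFunction v)⁻¹ : ℝ) : ℂ) • PolyFun.involution (PolyFun.leftTranslate v f) := by
      ext p
      simp [translate_apply, involution_apply, leftTranslate_apply, modularFunction_mul, mul_assoc]
    rw [h]
    exact Submodule.smul_mem _ _ (Submodule.mem_map_of_mem (f := involutionₛₗ) (hF v hv))

variable [MeasurableSpace G] [BorelSpace G] (μ : Measure G) [IsHaarMeasure μ]

omit [LocallyCompactSpace G] in
lemma IsPolynomial.conv_left (f : C_c(G, ℂ)) {g : C_c(G, ℂ)} (hg : IsPolynomial g) :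
    IsPolynomial (conv μ f g) :=
  hg.map ⟨⟨conv μ f, conv_add μ f⟩, fun c k => conv_smul μ c f k⟩ isOpen_univ (mem_univ _)
    fun v _ => by
      ext p
      simp [translate_apply, conv_apply, mul_assoc]

lemma IsPolynomial.conv_right {f : C_c(G, ℂ)} (hf : IsPolynomial f) (g : C_c(G, ℂ)) :
    IsPolynomial (conv μ f g) := by
  rw [← involution_involution (conv μ f g), involution_conv]
  exact (hf.involution.conv_left μ _).involution

/-- The value is `∫ δ(q) |f(q)|² dq`, with a continuous non-negative integrand. -/
lemma eq_zero_of_conv_involution_apply_one {f : C_c(G, ℂ)}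
    (h : conv μ f (involution f) 1 = 0) : f = 0 := by
  by_contra hf
  have hne : (fun q => modularFunction q * ‖f q‖ ^ 2) ≠ 0 := by
    contrapose! hf
    ext q
    simpa [(modularFunction_pos q).ne'] using congrFun hf q
  have hpos : 0 < ∫ q, modularFunction q * ‖f q‖ ^ 2 ∂μ := by
    obtain ⟨q, hq⟩ := Function.ne_iff.1 hne
    exact Continuous.integral_pos_of_hasCompactSupport_nonneg_nonzero
      (continuous_modularFunction.mul (f.continuous.norm.pow 2))
      (f.hasCompactSupport.comp_left (g := fun z : ℂ => ‖z‖ ^ 2) (by simp)).mul_left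
      (fun q => mul_nonneg (modularFunction_pos q).le (sq_nonneg _)) hq
  have heq : conv μ f (involution f) 1 = ((∫ q, modularFunction q * ‖f q‖ ^ 2 ∂μ : ℝ) : ℂ) := by
    rw [conv_apply, ← integral_complex_ofReal]
    congr 1
    ext q
    simp only [involution_apply, mul_one, inv_inv, modularFunction_inv, Complex.ofReal_mul,
      Complex.ofReal_pow, ← Complex.mul_conj']
    ring
  rw [heq, Complex.ofReal_eq_zero] at h
  exact hpos.ne' h

/-! ### Local units. -/

/-- Finitely many polynomial functions have a common polynomial right unit. -/
lemma exists_isPolynomial_conv_eq_self {H : Subgroup G} (hHc : IsCompact (H : Set G))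
    (hHo : IsOpen (H : Set G)) (S : Finset C_c(G, ℂ)) (hS : ∀ f ∈ S, IsPolynomial f) :
    ∃ g, IsPolynomial g ∧ ∀ f ∈ S, conv μ f g = f := by
  let T : C_c(G, ℂ) → Submodule ℂ C_c(G, ℂ) := fun f =>
    Submodule.span ℂ (range fun u => restrictSubgroup H hHo (leftTranslate u f))
  have hT : ∀ f ∈ S, FiniteDimensional ℂ (T f) := by
    intro f hf
    obtain ⟨F, _, hF⟩ := (hS f hf).exists_finiteDimensional hHc
    -- Here `V = H`, and the single coset `1 H` carries all supports.
    refine finiteDimensional_span_of_eq_left_translates hF {1} ?_ ?_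
    · rintro _ ⟨u, rfl⟩ p hp
      exact restrictSubgroup_apply_of_notMem hHo _ (by simpa using hp)
    · rintro _ ⟨u, rfl⟩ x hx
      refine ⟨u⁻¹, fun v hv => ?_⟩
      rw [Finset.mem_singleton.1 hx, one_mul, restrictSubgroup_apply_of_mem hHo _ hv,
        leftTranslate_apply]
  let N : Submodule ℂ C_c(G, ℂ) := polynomial G ⊓ supportedOn H
  let M : Submodule ℂ C_c(G, ℂ) := ⨆ f : S, T f
  have hMN : M ≤ N := by
    refine iSup_le fun f => Submodule.span_le.2 ?_
    rintro _ ⟨u, rfl⟩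
    exact ⟨((hS f f.2).leftTranslate u).restrictSubgroup hHo,
      fun p hp => restrictSubgroup_apply_of_notMem hHo _ hp⟩
  have : ∀ f : S, FiniteDimensional ℂ (T f) := fun f => hT f f.2
  let b : C_c(G, ℂ) →ₗ[ℂ] C_c(G, ℂ) →ₗ[ℂ] ℂ := LinearMap.mk₂ ℂ (fun g m => conv μ m g 1)
    (fun g g' m => by simp [conv_add]) (fun c g m => by simp [conv_smul])
    (fun g m m' => by simp [add_conv]) (fun c g m => by simp [smul_conv])
  let ev : C_c(G, ℂ) →ₗ[ℂ] ℂ :=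
    { toFun := fun m => m 1
      map_add' := fun _ _ => rfl
      map_smul' := fun _ _ => rfl }
  -- Test against `g = m*`, which lies in `N` because `H` is stable under inversion.
  have hb : ∀ m ∈ M, (∀ g ∈ N, b g m = 0) → m = 0 := fun m hm h =>
    have hmN := hMN hm
    eq_zero_of_conv_involution_apply_one μ (h (involution m) ⟨IsPolynomial.involution hmN.1,
      fun p hp => by
        rw [involution_apply, hmN.2 p⁻¹ fun h => hp (H.inv_mem_iff.1 h)]
        simp⟩)
  obtain ⟨g, ⟨hgp, hgH⟩, hg⟩ := exists_mem_forall_eq_of_separating b N M hb ev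
  refine ⟨g, hgp, fun f hf => ?_⟩
  ext p
  let m := restrictSubgroup H hHo (leftTranslate p⁻¹ f)
  have hm : m ∈ M := Submodule.mem_iSup_of_mem (p := fun f : S => T f) ⟨f, hf⟩
    (Submodule.subset_span ⟨p⁻¹, rfl⟩)
  have h1 : conv μ m g 1 = m 1 := hg m hm
  rw [restrictSubgroup_apply_of_mem hHo _ H.one_mem, leftTranslate_apply, inv_inv, mul_one] at h1
  -- After `q ↦ p q` the integrand of `(f * g)(p)` is `f (p q) g (q⁻¹)`. As `g` vanishes off `H`,
  -- replacing `q ↦ f (p q)` by its restriction `m` changes nothing.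
  rw [← h1, conv_apply, conv_apply, ← integral_mul_left_eq_self _ p]
  congr 1
  ext q
  by_cases hq : q ∈ H
  · simp [m, restrictSubgroup_apply_of_mem hHo _ hq, leftTranslate_apply]
  · simp [hgH q⁻¹ fun h => hq (H.inv_mem_iff.1 h)]

/-- Finitely many polynomial functions have a common polynomial two-sided unit. -/
lemma exists_isPolynomial_unit {H : Subgroup G} (hHc : IsCompact (H : Set G))
    (hHo : IsOpen (H : Set G)) (S : Finset C_c(G, ℂ)) (hS : ∀ f ∈ S, IsPolynomial f) :
    ∃ e, IsPolynomial e ∧ ∀ f ∈ S, conv μ e f = f ∧ conv μ f e = f := by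
  classical
  obtain ⟨b, hb, hbS⟩ := exists_isPolynomial_conv_eq_self μ hHc hHo S hS
  obtain ⟨a, ha, haS⟩ := exists_isPolynomial_conv_eq_self μ hHc hHo (S.image involution)
    (Finset.forall_mem_image.2 fun f hf => (hS f hf).involution)
  have haS' : ∀ f ∈ S, conv μ (involution a) f = f := fun f hf => by
    rw [← involution_involution (conv μ _ f), involution_conv, involution_involution,
      haS _ (Finset.mem_image_of_mem _ hf), involution_involution]
  let l : ConvAlg μ := (ConvAlg.toCc μ).symm (involution a)
  let r : ConvAlg μ := (ConvAlg.toCc μ).symm b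
  refine ⟨ConvAlg.toCc μ (l + r - r * l), ?_, fun f hf => ?_⟩
  · exact (polynomial G).sub_mem ((polynomial G).add_mem ha.involution hb)
      (IsPolynomial.conv_right μ hb _)
  · let x : ConvAlg μ := (ConvAlg.toCc μ).symm f
    have hl : l * x = x := haS' f hf
    have hr : x * r = x := hbS f hf
    constructor
    · change (l + r - r * l) * x = x
      rw [sub_mul, add_mul, mul_assoc, hl, add_sub_cancel_right]
    · change x * (l + r - r * l) = x
      rw [mul_sub, mul_add, ← mul_assoc, hr, add_sub_cancel_left]

/-! ### The subalgebra, the ideal and non-degeneracy. -/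

/-- The `*`-subalgebra of polynomial functions in the convolution algebra. -/
noncomputable def polynomialSubalgebra : NonUnitalStarSubalgebra ℂ (ConvAlg μ) where
  carrier := {f | IsPolynomial (ConvAlg.toCc μ f)}
  zero_mem' := (polynomial G).zero_mem
  add_mem' hf hg := (polynomial G).add_mem hf hg
  smul_mem' c _ hf := (polynomial G).smul_mem c hf
  mul_mem' {f _} _ hg := IsPolynomial.conv_left μ (ConvAlg.toCc μ f) hg
  star_mem' hf := IsPolynomial.involution hf

/-- The two-sided ideal of polynomial functions in the convolution algebra. -/
noncomputable def polynomialIdeal : TwoSidedIdeal (ConvAlg μ) :=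
  TwoSidedIdeal.mk' {f | IsPolynomial (ConvAlg.toCc μ f)} (polynomial G).zero_mem
    (fun hf hg => (polynomial G).add_mem hf hg) (fun hf => (polynomial G).neg_mem hf)
    (fun {f _} hg => IsPolynomial.conv_left μ (ConvAlg.toCc μ f) hg)
    (fun {_ g} hf => IsPolynomial.conv_right μ hf (ConvAlg.toCc μ g))

lemma hasLocalUnits_polynomialSubalgebra {H : Subgroup G} (hHc : IsCompact (H : Set G))
    (hHo : IsOpen (H : Set G)) : HasLocalUnits (polynomialSubalgebra μ) := by
  classical
  intro s
  obtain ⟨e, he, hes⟩ := exists_isPolynomial_unit μ hHc hHo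
    (s.image fun f : polynomialSubalgebra μ => ConvAlg.toCc μ f.1) (Finset.forall_mem_image.2 fun f _ => f.2)
  refine ⟨⟨(ConvAlg.toCc μ).symm e, he⟩, fun f hf => ?_⟩
  have h := hes _ (Finset.mem_image_of_mem _ hf)
  exact ⟨Subtype.ext h.1, Subtype.ext h.2⟩

/-- The product of an algebra with local units is non-degenerate. -/
lemma HasLocalUnits.nondegenerate_mul {A : Type*} [NonUnitalRing A] [Module ℂ A]
    [IsScalarTower ℂ A A] [SMulCommClass ℂ A A] (hA : HasLocalUnits A) :
    (LinearMap.mul ℂ A).Nondegenerate := by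
  refine ⟨fun a ha => ?_, fun a ha => ?_⟩ <;> obtain ⟨e, he⟩ := hA {a}
  · rw [← (he a (Finset.mem_singleton_self a)).2]
    exact ha e
  · rw [← (he a (Finset.mem_singleton_self a)).1]
    exact ha e

end Convolution

end PolyFun

theorem mainTheorem10 {G : Type*} [Group G] [TopologicalSpace G] [IsTopologicalGroup G]
    [LocallyCompactSpace G] [MeasurableSpace G] [BorelSpace G]
    (μ : Measure G) [μ.IsHaarMeasure]
    (hG : ∃ G₀ : Subgroup G, IsCompact (G₀ : Set G) ∧ IsOpen (G₀ : Set G)) :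
    (∀ f f' : C_c(G, ℂ), PolyFun.IsPolynomial f ∨ PolyFun.IsPolynomial f' → PolyFun.IsPolynomial (PolyFun.conv μ f f')) ∧
    (∃ I : TwoSidedIdeal (PolyFun.ConvAlg μ),
      ∀ f : PolyFun.ConvAlg μ, f ∈ I ↔ PolyFun.IsPolynomial (PolyFun.ConvAlg.toCc μ f)) ∧
    (∃ P : NonUnitalStarSubalgebra ℂ (PolyFun.ConvAlg μ),
      (∀ f : PolyFun.ConvAlg μ, f ∈ P ↔ PolyFun.IsPolynomial (PolyFun.ConvAlg.toCc μ f)) ∧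
      PolyFun.HasLocalUnits P ∧
      (LinearMap.mul ℂ P).Nondegenerate) := by
  obtain ⟨H, hHc, hHo⟩ := hG
  have hP := PolyFun.hasLocalUnits_polynomialSubalgebra μ hHc hHo
  refine ⟨fun f f' h => h.elim (fun hf => hf.conv_right μ f') (fun hf' => hf'.conv_left μ f),
    ⟨PolyFun.polynomialIdeal μ, fun f => ?_⟩,
    PolyFun.polynomialSubalgebra μ, fun _ => Iff.rfl, hP, hP.nondegenerate_mul⟩
  exact TwoSidedIdeal.mem_mk' ..
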